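/- Let $G$ be a group (for instance a finite group or a compact Lie group) and let $U$ be a unitary representation of $G$ on a finite-dimensional complex Hilbert space $\mathcal H$. Then $U$ admits a decomposition into irreps, i.e. an orthogonal decomposition $$\mathcal H=\bigoplus_{\mu}\mathcal M_\mu\otimes\mathcal N_\mu,\qquad U(g)=\bigoplus_\mu U_\mu(g)\otimes I_{\mathcal N_\mu}\quad(g\in G),$$ with finitely many $\mu$ and finite-dimensional Hilbert spaces $\mathcal M_\mu,\mathcal N_\mu$, where the $U_\mu$ are pairwise inequivalent irreducible unitary representations of $G$ on $\mathcal M_\mu$. Fix any such decomposition and let $\Pi_\mu$ be the orthogonal projection onto $\mathcal M_\mu\otimes\mathcal N_\mu$. For unit vectors $\psi_1,\psi_2\in\mathcal H$ let $$F_i^{(\mu)}=\mathrm{tr}_{\mathcal N_\mu}\bigl(\Pi_\mu|\psi_i\rangle\langle\psi_i|\Pi_\mu\bigr),\qquad i=1,2,$$ be their reductions onto irreps, which are positive operators on $\mathcal M_\mu$. For positive operators $A,B$ put $\mathrm{Fid}(A,B)=\|\sqrt A\sqrt B\|_1$, where $\|X\|_1=\mathrm{tr}\sqrt{X^\dagger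 X}$ is the trace norm. A unitary $V$ on $\mathcal H$ is called $G$-invariant if $VU(g)=U(g)V$ for all $g\in G$. Then every $G$-invariant unitary $V$ on $\mathcal H$ satisfies $$|\langle\psi_2|V|\psi_1\rangle|\le\sum_\mu\mathrm{Fid}\bigl(F_1^{(\mu)},F_2^{(\mu)}\bigr),$$ and there exists a $G$-invariant unitary $V$ on $\mathcal H$ for which equality holds. -/

import Mathlib

open scoped TensorProduct

universe w u v

noncomputable section

namespace Asymmetry

/-- The linear representation underlying a unitary representation `g ↦ U g`. -/
def toRepresentation {G H : Type*} [Group G] [NormedAddCommGroup H] [InnerProductSpace ℂ H]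
    (U : G →* (H ≃ₗᵢ[ℂ] H)) : Representation ℂ G H where
  toFun g := (U g).toLinearEquiv.toLinearMap
  map_one' := by ext x; simp
  map_mul' g h := by ext x; simp

/-- A unitary `V` is `G`-invariant if `V U(g) = U(g) V` for all `g`. -/
def IsGInvariant {G H : Type*} [Group G] [NormedAddCommGroup H] [InnerProductSpace ℂ H]
    (U : G →* (H ≃ₗᵢ[ℂ] H)) (V : H ≃ₗᵢ[ℂ] H) : Prop :=
  ∀ g : G, V * U g = U g * V

section Operators

variable {M : Type*} [NormedAddCommGroup M] [InnerProductSpace ℂ M] [FiniteDimensional ℂ M]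

/-- The square root of a positive operator. -/
def opSqrt (A : M →L[ℂ] M) : M →L[ℂ] M :=
  haveI : CompleteSpace M := FiniteDimensional.complete ℂ M
  CFC.sqrt A

/-- The trace norm `‖A‖₁ = tr √(A† A)`. -/
def traceNorm (A : M →L[ℂ] M) : ℝ :=
  haveI : CompleteSpace M := FiniteDimensional.complete ℂ M
  (LinearMap.trace ℂ M (opSqrt (ContinuousLinearMap.adjoint A ∘L A)).toLinearMap).re

/-- The fidelity `Fid(A, B) = ‖√A √B‖₁` of two positive operators. -/
def fid (A B : M →L[ℂ] M) : ℝ :=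
  traceNorm (opSqrt A ∘L opSqrt B)

variable {N : Type*} [NormedAddCommGroup N] [InnerProductSpace ℂ N] [FiniteDimensional ℂ N]

/-- The partial trace over the second factor: the linear map with `tr_N (A ⊗ B) = tr(B) A`. -/
def partialTrace : ((M ⊗[ℂ] N) →ₗ[ℂ] (M ⊗[ℂ] N)) →ₗ[ℂ] (M →ₗ[ℂ] M) :=
  (TensorProduct.rid ℂ (M →ₗ[ℂ] M)).toLinearMap ∘ₗ
    LinearMap.lTensor (M →ₗ[ℂ] M) (LinearMap.trace ℂ N) ∘ₗ
      (homTensorHomEquiv ℂ M N M N).symm.toLinearMap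

theorem partialTrace_map (A : M →ₗ[ℂ] M) (B : N →ₗ[ℂ] N) :
    partialTrace (TensorProduct.map A B) = LinearMap.trace ℂ N B • A := by
  have h : (homTensorHomEquiv ℂ M N M N).symm (TensorProduct.map A B) = A ⊗ₜ[ℂ] B := by
    rw [LinearEquiv.symm_apply_eq]
    simp [homTensorHomEquiv_apply]
  simp [partialTrace, h]

end Operators

/-- A decomposition `H = ⨁_μ M_μ ⊗ N_μ` of a unitary representation into irreps: the `M_μ` carry
pairwise inequivalent irreducible unitary representations `U_μ`, the `N_μ` are the multiplicity
spaces, and `U(g) = ⨁_μ U_μ(g) ⊗ 1`. The orthogonal direct sum is given by the isometric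
inclusions of its summands. -/
structure IrrepDecomposition {G : Type u} {H : Type v} [Group G] [NormedAddCommGroup H]
    [InnerProductSpace ℂ H] (U : G →* (H ≃ₗᵢ[ℂ] H)) where
  /-- the labels `μ` -/
  Index : Type w
  [fintypeIndex : Fintype Index]
  /-- the spaces on which the irreps act -/
  M : Index → Type w
  [normedM : ∀ μ, NormedAddCommGroup (M μ)]
  [innerM : ∀ μ, InnerProductSpace ℂ (M μ)]
  [finiteM : ∀ μ, FiniteDimensional ℂ (M μ)]
  /-- the multiplicity spaces -/
  N : Index → Type w
  [normedN : ∀ μ, NormedAddCommGroup (N μ)]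
  [innerN : ∀ μ, InnerProductSpace ℂ (N μ)]
  [finiteN : ∀ μ, FiniteDimensional ℂ (N μ)]
  /-- the irreps `U_μ` -/
  irrep : ∀ μ, G →* (M μ ≃ₗᵢ[ℂ] M μ)
  irreducible : ∀ μ, (toRepresentation (irrep μ)).IsIrreducible
  inequivalent : ∀ μ ν, μ ≠ ν →
    IsEmpty ((toRepresentation (irrep μ)).Equiv (toRepresentation (irrep ν)))
  /-- the inclusions of the summands `M_μ ⊗ N_μ` -/
  incl : ∀ μ, (M μ ⊗[ℂ] N μ) →ₗᵢ[ℂ] H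
  orthogonal : OrthogonalFamily ℂ (fun μ => M μ ⊗[ℂ] N μ) incl
  iSup_range : ⨆ μ, LinearMap.range (incl μ).toLinearMap = ⊤
  map_incl : ∀ (g : G) (μ : Index) (m : M μ) (n : N μ),
    U g (incl μ (m ⊗ₜ[ℂ] n)) = incl μ (irrep μ g m ⊗ₜ[ℂ] n)

attribute [instance] IrrepDecomposition.fintypeIndex IrrepDecomposition.normedM
  IrrepDecomposition.innerM IrrepDecomposition.finiteM IrrepDecomposition.normedN
  IrrepDecomposition.innerN IrrepDecomposition.finiteN

namespace IrrepDecomposition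

variable {G H : Type*} [Group G] [NormedAddCommGroup H] [InnerProductSpace ℂ H]
  [FiniteDimensional ℂ H] {U : G →* (H ≃ₗᵢ[ℂ] H)}

/-- The orthogonal projection `Π_μ` of `H` onto the summand `M_μ ⊗ N_μ`. -/
def proj (D : IrrepDecomposition U) (μ : D.Index) : H →ₗ[ℂ] H :=
  (LinearMap.range (D.incl μ).toLinearMap).starProjection.toLinearMap

/-- The component `ρ^(μ) = tr_{N_μ} (Π_μ ρ Π_μ)` of the reduction of `ρ` onto irreps; here
`Π_μ ρ Π_μ` is read as an operator on `M_μ ⊗ N_μ`. -/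
def reduction (D : IrrepDecomposition U) (ρ : H →ₗ[ℂ] H) (μ : D.Index) :
    D.M μ →L[ℂ] D.M μ :=
  LinearMap.toContinuousLinearMap (partialTrace
    (LinearMap.adjoint (D.incl μ).toLinearMap ∘ₗ (D.proj μ ∘ₗ ρ ∘ₗ D.proj μ) ∘ₗ
      (D.incl μ).toLinearMap))

/-- The reduction onto irreps of the pure state `|ψ⟩⟨ψ|`. -/
def pureReduction (D : IrrepDecomposition U) (ψ : H) (μ : D.Index) : D.M μ →L[ℂ] D.M μ :=
  D.reduction (InnerProductSpace.rankOne ℂ ψ ψ).toLinearMap μ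

end IrrepDecomposition

end Asymmetry

end

/-! By Schur's lemma a `G`-invariant unitary is block diagonal and acts on the block `M_μ ⊗ N_μ` as
`1 ⊗ Y_μ`; conversely, any unitaries `Y_μ` on the multiplicity spaces assemble to an invariant
unitary. With `φᵢ^μ` the component of `ψᵢ` in block `μ`, the overlap is therefore a sum of terms
`⟪φ₂^μ, (1 ⊗ Y_μ) φ₁^μ⟫` in which the `Y_μ` can be chosen independently. Since `φᵢ^μ` purifies
`Fᵢ^(μ)`, Uhlmann's theorem bounds each term by the fidelity, and some unitary `Y_μ` makes the term
equal to it with no phase left over, so that the equalities add up (`norm_inner_lTensor_le_fid`,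
`exists_inner_lTensor_eq_fid`).

For Uhlmann's theorem, a vector of `M ⊗ N` is encoded as an operator `A : N → M`. Its reduction is
`A A†`, and overlaps become traces `tr(A† B C)`, with `C` the complex conjugate of `Y`. Polar
decompositions of `A†` and `B†` pass between `A† B` and `√F₁ √F₂`, and the trace norm is the maximum
of `|tr(C X)|` over contractions `C`, attained at a unitary.

A decomposition exists because, for each class of irreps occurring in `U`, evaluating intertwiners
at a unit vector yields a multiplicity space and an isotypic block. Blocks of different classes are
orthogonal, hence finitely many. The orthogonal complement of their sum is invariant; were it
nonzero, it would contain an irrep, whose image already lies in one of the blocks. -/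

noncomputable section

namespace Asymmetry

/-! ### Polar decomposition and traces against contractions -/

section Polar

variable {M E : Type*} [NormedAddCommGroup M] [InnerProductSpace ℂ M]
  [NormedAddCommGroup E] [InnerProductSpace ℂ E]

/-- If `‖K x‖ = ‖P x‖` for all `x`, then `P x ↦ K x` is a well-defined isometry on the range
of `P`. -/
theorem exists_isometry_range {V : Type*} [AddCommGroup V] [Module ℂ V]
    (P : V →ₗ[ℂ] M) (K : V →ₗ[ℂ] E) (h : ∀ x, ‖K x‖ = ‖P x‖) :
    ∃ L : LinearMap.range P →ₗᵢ[ℂ] E, ∀ x, L ⟨P x, LinearMap.mem_range_self P x⟩ = K x := by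
  obtain ⟨s, hs⟩ := P.rangeRestrict.exists_rightInverse_of_surjective P.range_rangeRestrict
  have hs' : ∀ y, P (s y) = y := fun y => congrArg Subtype.val (LinearMap.congr_fun hs y)
  refine ⟨⟨K ∘ₗ s, fun y => ?_⟩, fun x => ?_⟩
  · rw [LinearMap.comp_apply, h, hs', Submodule.coe_norm]
  · change K (s ⟨P x, _⟩) = K x
    -- `s (P x)` and `x` differ by an element of `ker P`, which `K` kills because the norms agree.
    rw [← sub_eq_zero, ← map_sub, ← norm_eq_zero, h, map_sub, hs', sub_self, norm_zero]

variable [FiniteDimensional ℂ M] [FiniteDimensional ℂ E]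

theorem norm_adjoint_le_of_contraction {T : M →ₗ[ℂ] E} (hT : ∀ x, ‖T x‖ ≤ ‖x‖) (y : E) :
    ‖LinearMap.adjoint T y‖ ≤ ‖y‖ := by
  have h1 : ‖LinearMap.adjoint T y‖ * ‖LinearMap.adjoint T y‖
      ≤ ‖y‖ * ‖LinearMap.adjoint T y‖ := by
    rw [← inner_self_eq_norm_mul_norm (𝕜 := ℂ), LinearMap.adjoint_inner_left]
    exact (re_inner_le_norm _ _).trans (by gcongr; exact hT _)
  rcases (norm_nonneg (LinearMap.adjoint T y)).eq_or_lt with h | h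
  · rw [← h]; exact norm_nonneg y
  · exact le_of_mul_le_mul_right h1 h

/-- The partial isometry of a polar decomposition. -/
theorem exists_contraction_polar (P : M →ₗ[ℂ] M) (K : M →ₗ[ℂ] E) (h : ∀ x, ‖K x‖ = ‖P x‖) :
    ∃ T : M →ₗ[ℂ] E, (∀ x, ‖T x‖ ≤ ‖x‖) ∧ T ∘ₗ P = K ∧ LinearMap.adjoint T ∘ₗ K = P := by
  obtain ⟨L, hL⟩ := exists_isometry_range P K h
  let T : M →ₗ[ℂ] E := L.toLinearMap ∘ₗ (LinearMap.range P).orthogonalProjectionOnto.toLinearMap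
  have hTP : ∀ x, T (P x) = K x := fun x => by
    rw [← hL x]
    change L _ = _
    congr 1
    exact Submodule.orthogonalProjectionOnto_mem_subspace_eq_self
      (⟨P x, LinearMap.mem_range_self P x⟩ : LinearMap.range P)
  refine ⟨T, fun x => ?_, LinearMap.ext hTP, LinearMap.ext fun x => ?_⟩
  · change ‖L _‖ ≤ _
    rw [L.norm_map]
    exact Submodule.norm_orthogonalProjectionOnto_apply_le _ _
  · refine ext_inner_left ℂ fun y => ?_
    rw [LinearMap.comp_apply, LinearMap.adjoint_inner_right, ← hL x]
    change inner ℂ (L _) (L _) = _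
    rw [L.inner_map_map]
    exact Submodule.inner_orthogonalProjectionOnto_eq_of_mem_right ⟨P x, _⟩ y

/-- The unitary of a polar decomposition. -/
theorem exists_unitary_polar (P K : M →ₗ[ℂ] M) (h : ∀ x, ‖K x‖ = ‖P x‖) :
    ∃ W : M ≃ₗᵢ[ℂ] M, ∀ x, W (P x) = K x := by
  obtain ⟨L, hL⟩ := exists_isometry_range P K h
  -- In finite dimension the partial isometry extends to all of `M`, and an isometry of `M` into
  -- itself is onto.
  refine ⟨L.extend.toLinearIsometryEquiv rfl, fun x => ?_⟩
  rw [← hL x, LinearIsometry.coe_toLinearIsometryEquiv, ← L.extend_apply]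

/-- In an eigenbasis of `S` the trace is `∑ λᵢ ⟪bᵢ, C bᵢ⟫` with `λᵢ ≥ 0`, and each inner product has
modulus at most one. -/
theorem norm_trace_comp_le_of_isPositive {C S : M →ₗ[ℂ] M} (hC : ∀ x, ‖C x‖ ≤ ‖x‖)
    (hS : S.IsPositive) : ‖LinearMap.trace ℂ M (C ∘ₗ S)‖ ≤ (LinearMap.trace ℂ M S).re := by
  let b := hS.isSymmetric.eigenvectorBasis rfl
  have h2 : (LinearMap.trace ℂ M S).re = ∑ i, hS.isSymmetric.eigenvalues rfl i :=
    hS.isSymmetric.re_trace_eq_sum_eigenvalues rfl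
  rw [LinearMap.trace_eq_sum_inner _ b, h2]
  refine (norm_sum_le _ _).trans (Finset.sum_le_sum fun i _ => ?_)
  have h3 : S (b i) = (hS.isSymmetric.eigenvalues rfl i : ℂ) • b i :=
    hS.isSymmetric.apply_eigenvectorBasis rfl i
  have h4 := hS.nonneg_eigenvalues rfl i
  rw [LinearMap.comp_apply, h3, map_smul, inner_smul_right, norm_mul, Complex.norm_real,
    Real.norm_of_nonneg h4]
  refine mul_le_of_le_one_right h4 ?_
  have hb : ‖b i‖ = 1 := b.orthonormal.1 i
  calc _ ≤ ‖b i‖ * ‖C (b i)‖ := norm_inner_le_norm _ _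
    _ ≤ 1 * 1 := by gcongr; exacts [hb.le, (hC _).trans hb.le]
    _ = 1 := one_mul 1

end Polar

/-! ### Variational characterization of the trace norm -/

section TraceNorm

variable {M : Type*} [NormedAddCommGroup M] [InnerProductSpace ℂ M] [FiniteDimensional ℂ M]

theorem isPositive_opSqrt (A : M →L[ℂ] M) : (opSqrt A).toLinearMap.IsPositive := by
  have : CompleteSpace M := FiniteDimensional.complete ℂ M
  rw [ContinuousLinearMap.isPositive_toLinearMap_iff]
  exact (ContinuousLinearMap.nonneg_iff_isPositive _).1 (CFC.sqrt_nonneg A)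

theorem adjoint_opSqrt (A : M →L[ℂ] M) :
    LinearMap.adjoint (opSqrt A).toLinearMap = (opSqrt A).toLinearMap :=
  LinearMap.isSelfAdjoint_iff'.1 (isPositive_opSqrt A).isSelfAdjoint

theorem opSqrt_comp_opSqrt {A : M →L[ℂ] M} (hA : A.toLinearMap.IsPositive) :
    (opSqrt A).toLinearMap ∘ₗ (opSqrt A).toLinearMap = A.toLinearMap := by
  have : CompleteSpace M := FiniteDimensional.complete ℂ M
  rw [ContinuousLinearMap.isPositive_toLinearMap_iff] at hA
  exact congrArg ContinuousLinearMap.toLinearMap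
    (CFC.sqrt_mul_sqrt_self A ((ContinuousLinearMap.nonneg_iff_isPositive _).2 hA))

/-- The square root of `K† K` has the same norms as `K`. -/
theorem norm_apply_eq_norm_opSqrt_apply {E : Type*} [NormedAddCommGroup E] [InnerProductSpace ℂ E]
    [FiniteDimensional ℂ E] (A : M →L[ℂ] M) (K : M →ₗ[ℂ] E)
    (hA : A.toLinearMap = LinearMap.adjoint K ∘ₗ K) (x : M) :
    ‖K x‖ = ‖(opSqrt A).toLinearMap x‖ := by
  have hpos : A.toLinearMap.IsPositive := hA ▸ LinearMap.isPositive_adjoint_comp_self K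
  have h : inner ℂ (K x) (K x)
      = inner ℂ ((opSqrt A).toLinearMap x) ((opSqrt A).toLinearMap x) := by
    rw [← LinearMap.adjoint_inner_right, ← LinearMap.comp_apply, ← hA,
      ← opSqrt_comp_opSqrt hpos, LinearMap.comp_apply, ← LinearMap.adjoint_inner_left,
      adjoint_opSqrt]
  rw [inner_self_eq_norm_sq_to_K, inner_self_eq_norm_sq_to_K] at h
  exact (sq_eq_sq₀ (norm_nonneg _) (norm_nonneg _)).1 (by exact_mod_cast h)

theorem traceNorm_eq (X : M →L[ℂ] M) : ∃ S : M →ₗ[ℂ] M, S.IsPositive ∧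
    (∀ x, ‖X x‖ = ‖S x‖) ∧ traceNorm X = (LinearMap.trace ℂ M S).re := by
  have : CompleteSpace M := FiniteDimensional.complete ℂ M
  exact ⟨_, isPositive_opSqrt _, norm_apply_eq_norm_opSqrt_apply
    (ContinuousLinearMap.adjoint X ∘L X) X.toLinearMap rfl, rfl⟩

/-- Polar decomposition `X = W S` absorbs `W` into the contraction and leaves the positive case. -/
theorem norm_trace_comp_le_traceNorm {C : M →ₗ[ℂ] M} (hC : ∀ x, ‖C x‖ ≤ ‖x‖) (X : M →L[ℂ] M) :
    ‖LinearMap.trace ℂ M (C ∘ₗ X.toLinearMap)‖ ≤ traceNorm X := by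
  obtain ⟨S, hS, hX, h⟩ := traceNorm_eq X
  obtain ⟨W, hW⟩ := exists_unitary_polar S X.toLinearMap hX
  have h1 : C ∘ₗ X.toLinearMap = (C ∘ₗ W.toLinearEquiv.toLinearMap) ∘ₗ S := by
    ext x; exact congrArg C (hW x).symm
  rw [h, h1]
  exact norm_trace_comp_le_of_isPositive (fun x => (hC _).trans (W.norm_map x).le) hS

theorem exists_trace_comp_eq_traceNorm (X : M →L[ℂ] M) : ∃ W : M ≃ₗᵢ[ℂ] M,
    LinearMap.trace ℂ M (W.toLinearEquiv.toLinearMap ∘ₗ X.toLinearMap) = traceNorm X := by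
  obtain ⟨S, hS, hX, h⟩ := traceNorm_eq X
  obtain ⟨W, hW⟩ := exists_unitary_polar S X.toLinearMap hX
  refine ⟨W.symm, ?_⟩
  have h1 : W.symm.toLinearEquiv.toLinearMap ∘ₗ X.toLinearMap = S := by
    ext x; exact (W.symm_apply_eq).2 (hW x).symm
  rw [h1, h, hS.isSymmetric.trace_eq_sum_eigenvalues rfl]
  simp

end TraceNorm

/-! ### Fidelity as an extremal trace -/

section Fidelity

variable {M N : Type*} [NormedAddCommGroup M] [InnerProductSpace ℂ M] [FiniteDimensional ℂ M]
  [NormedAddCommGroup N] [InnerProductSpace ℂ N] [FiniteDimensional ℂ N]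

/-- `|tr(A† B C)| ≤ Fid(A A†, B B†)` for every contraction `C`. -/
theorem norm_trace_le_fid (A B : N →ₗ[ℂ] M) {F₁ F₂ : M →L[ℂ] M}
    (h₁ : F₁.toLinearMap = A ∘ₗ LinearMap.adjoint A)
    (h₂ : F₂.toLinearMap = B ∘ₗ LinearMap.adjoint B)
    {C : N →ₗ[ℂ] N} (hC : ∀ x, ‖C x‖ ≤ ‖x‖) :
    ‖LinearMap.trace ℂ N (LinearMap.adjoint A ∘ₗ B ∘ₗ C)‖ ≤ fid F₁ F₂ := by
  obtain ⟨S, hS, hSA, -⟩ := exists_contraction_polar (opSqrt F₁).toLinearMap (LinearMap.adjoint A)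
    (norm_apply_eq_norm_opSqrt_apply _ _ (by rw [LinearMap.adjoint_adjoint, h₁]))
  obtain ⟨T, hT, hTB, -⟩ := exists_contraction_polar (opSqrt F₂).toLinearMap (LinearMap.adjoint B)
    (norm_apply_eq_norm_opSqrt_apply _ _ (by rw [LinearMap.adjoint_adjoint, h₂]))
  have hB : B = (opSqrt F₂).toLinearMap ∘ₗ LinearMap.adjoint T := by
    rw [← LinearMap.adjoint_adjoint B, ← hTB, LinearMap.adjoint_comp, adjoint_opSqrt]
  have h : LinearMap.trace ℂ N (LinearMap.adjoint A ∘ₗ B ∘ₗ C)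
      = LinearMap.trace ℂ M ((LinearMap.adjoint T ∘ₗ C ∘ₗ S) ∘ₗ
        (opSqrt F₁ ∘L opSqrt F₂).toLinearMap) := by
    rw [← hSA, hB, ContinuousLinearMap.toLinearMap_comp]
    exact LinearMap.trace_comp_comm' (LinearMap.adjoint T ∘ₗ C)
      (S ∘ₗ (opSqrt F₁).toLinearMap ∘ₗ (opSqrt F₂).toLinearMap)
  rw [h]
  exact norm_trace_comp_le_traceNorm (fun x => (norm_adjoint_le_of_contraction hT _).trans
    ((hC _).trans (hS x))) _

/-- `Fid(A A†, B B†)` is the value of `tr(A† B W)` at some unitary `W`. -/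
theorem exists_trace_eq_fid (A B : N →ₗ[ℂ] M) {F₁ F₂ : M →L[ℂ] M}
    (h₁ : F₁.toLinearMap = A ∘ₗ LinearMap.adjoint A)
    (h₂ : F₂.toLinearMap = B ∘ₗ LinearMap.adjoint B) :
    ∃ W : N ≃ₗᵢ[ℂ] N, LinearMap.trace ℂ N
      (LinearMap.adjoint A ∘ₗ B ∘ₗ W.toLinearEquiv.toLinearMap) = fid F₁ F₂ := by
  obtain ⟨S, hS, -, hSA⟩ := exists_contraction_polar (opSqrt F₁).toLinearMap (LinearMap.adjoint A)
    (norm_apply_eq_norm_opSqrt_apply _ _ (by rw [LinearMap.adjoint_adjoint, h₁]))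
  obtain ⟨T, hT, -, hTB⟩ := exists_contraction_polar (opSqrt F₂).toLinearMap (LinearMap.adjoint B)
    (norm_apply_eq_norm_opSqrt_apply _ _ (by rw [LinearMap.adjoint_adjoint, h₂]))
  have hB : (opSqrt F₂).toLinearMap = B ∘ₗ T := by
    rw [← adjoint_opSqrt, ← hTB, LinearMap.adjoint_comp, LinearMap.adjoint_adjoint,
      LinearMap.adjoint_adjoint]
  let Z : N →L[ℂ] N := LinearMap.toContinuousLinearMap (LinearMap.adjoint A ∘ₗ B)
  obtain ⟨X, hX⟩ := exists_trace_comp_eq_traceNorm (opSqrt F₁ ∘L opSqrt F₂)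
  obtain ⟨W, hW⟩ := exists_trace_comp_eq_traceNorm Z
  -- With `√F₁ = S† A†` and `√F₂ = B T`, the fidelity is `tr(X S† A† B T)`; cycling `T` to the front
  -- exhibits it as the trace of a contraction times `Z`.
  have hle : fid F₁ F₂ ≤ traceNorm Z := by
    have h : (fid F₁ F₂ : ℂ) = LinearMap.trace ℂ N
        ((T ∘ₗ X.toLinearEquiv.toLinearMap ∘ₗ LinearMap.adjoint S) ∘ₗ Z.toLinearMap) := by
      rw [fid, ← hX, ContinuousLinearMap.toLinearMap_comp, hB, ← hSA]
      exact LinearMap.trace_comp_comm' T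
        (X.toLinearEquiv.toLinearMap ∘ₗ LinearMap.adjoint S ∘ₗ LinearMap.adjoint A ∘ₗ B)
    refine (le_abs_self _).trans ?_
    rw [← Real.norm_eq_abs, ← Complex.norm_real, h]
    exact norm_trace_comp_le_traceNorm (fun x => (hT _).trans ((X.norm_map _).le.trans
      (norm_adjoint_le_of_contraction hS x))) _
  have hW' : LinearMap.trace ℂ N (LinearMap.adjoint A ∘ₗ B ∘ₗ W.toLinearEquiv.toLinearMap)
      = traceNorm Z := by
    rw [← hW]
    exact LinearMap.trace_comp_comm' W.toLinearEquiv.toLinearMap (LinearMap.adjoint A ∘ₗ B)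
  refine ⟨W, ?_⟩
  have hge := norm_trace_le_fid A B h₁ h₂ (C := W.toLinearEquiv.toLinearMap)
    (fun x => (W.norm_map x).le)
  rw [hW', Complex.norm_real, Real.norm_eq_abs] at hge
  rw [hW', le_antisymm hle ((le_abs_self _).trans hge)]

end Fidelity

/-! ### Complex conjugation in an orthonormal basis -/

section Conjugation

variable {N : Type*} [NormedAddCommGroup N] [InnerProductSpace ℂ N] {ι : Type*} [Fintype ι]

/-- Complex conjugation of the coordinates in an orthonormal basis. -/
def basisConj (e : OrthonormalBasis ι ℂ N) : N →ₗ⋆[ℂ] N where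
  toFun x := ∑ j, inner ℂ x (e j) • e j
  map_add' x y := by simp [add_smul, Finset.sum_add_distrib]
  map_smul' c x := by
    simp [mul_smul, Finset.smul_sum, smul_comm (inner ℂ x _)]

theorem basisConj_apply (e : OrthonormalBasis ι ℂ N) (x : N) :
    basisConj e x = ∑ j, inner ℂ x (e j) • e j := rfl

theorem inner_basisConj (e : OrthonormalBasis ι ℂ N) (x y : N) :
    inner ℂ (basisConj e x) (basisConj e y) = inner ℂ y x := by
  rw [basisConj_apply, basisConj_apply, e.orthonormal.inner_sum, ← e.sum_inner_mul_inner y x]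
  exact Finset.sum_congr rfl fun j _ => by rw [inner_conj_symm, mul_comm]

theorem norm_basisConj (e : OrthonormalBasis ι ℂ N) (x : N) : ‖basisConj e x‖ = ‖x‖ := by
  rw [norm_eq_sqrt_re_inner (𝕜 := ℂ), inner_basisConj, ← norm_eq_sqrt_re_inner]

theorem basisConj_basis (e : OrthonormalBasis ι ℂ N) (j : ι) : basisConj e (e j) = e j := by
  classical
  simp [basisConj_apply, e.inner_eq_ite]

theorem basisConj_basisConj (e : OrthonormalBasis ι ℂ N) (x : N) :
    basisConj e (basisConj e x) = x := by
  conv_rhs => rw [← e.sum_repr' x]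
  rw [basisConj_apply e x, map_sum]
  exact Finset.sum_congr rfl fun j _ => by
    rw [map_smulₛₗ, basisConj_basis, inner_conj_symm]

/-- The operator whose matrix in the basis `e` is the complex conjugate of that of `Y`. -/
def conjOp (e : OrthonormalBasis ι ℂ N) (Y : N →ₗ[ℂ] N) : N →ₗ[ℂ] N :=
  basisConj e ∘ₛₗ Y ∘ₛₗ basisConj e

theorem conjOp_apply (e : OrthonormalBasis ι ℂ N) (Y : N →ₗ[ℂ] N) (x : N) :
    conjOp e Y x = basisConj e (Y (basisConj e x)) := rfl

theorem conjOp_conjOp (e : OrthonormalBasis ι ℂ N) (Y : N →ₗ[ℂ] N) :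
    conjOp e (conjOp e Y) = Y := by
  ext x; simp [conjOp_apply, basisConj_basisConj]

theorem norm_conjOp_apply (e : OrthonormalBasis ι ℂ N) (Y : N →ₗ[ℂ] N) (x : N) :
    ‖conjOp e Y x‖ = ‖Y (basisConj e x)‖ := by
  rw [conjOp_apply, norm_basisConj]

end Conjugation

/-! ### Uhlmann's theorem for vectors in a tensor product -/

section Purification

variable {M N : Type*} [NormedAddCommGroup M] [InnerProductSpace ℂ M]
  [NormedAddCommGroup N] [InnerProductSpace ℂ N] {ι : Type*} [Fintype ι]

theorem exists_eq_sum_tmul_basis (e : OrthonormalBasis ι ℂ N) (φ : M ⊗[ℂ] N) :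
    ∃ A : N →ₗ[ℂ] M, φ = ∑ j, A (e j) ⊗ₜ[ℂ] e j := by
  induction φ with
  | zero => exact ⟨0, by simp⟩
  | tmul m n =>
    refine ⟨e.toBasis.constr ℂ fun j => inner ℂ (e j) n • m, ?_⟩
    have h : ∀ j, e.toBasis.constr ℂ (fun j => inner ℂ (e j) n • m) (e j)
        = inner ℂ (e j) n • m := fun j => by
      rw [← e.coe_toBasis, Module.Basis.constr_basis]
    simp only [h, TensorProduct.smul_tmul]
    rw [← TensorProduct.tmul_sum, e.sum_repr']
  | add x y hx hy =>
    obtain ⟨A, hA⟩ := hx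
    obtain ⟨B, hB⟩ := hy
    exact ⟨A + B, by simp [TensorProduct.add_tmul, Finset.sum_add_distrib, ← hA, ← hB]⟩

theorem toLinearMap_rankOne_tmul (m m' : M) (n n' : N) :
    (InnerProductSpace.rankOne ℂ (m ⊗ₜ[ℂ] n) (m' ⊗ₜ[ℂ] n')).toLinearMap
      = TensorProduct.map (InnerProductSpace.rankOne ℂ m m').toLinearMap
          (InnerProductSpace.rankOne ℂ n n').toLinearMap := by
  ext x y
  simp [mul_smul, smul_comm (inner ℂ m' x), TensorProduct.smul_tmul']

variable [FiniteDimensional ℂ M] [FiniteDimensional ℂ N]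

/-- The trace over `N` kills the cross terms `j ≠ k` and leaves `∑ |A eⱼ⟩⟨A eⱼ| = A A†`. -/
theorem partialTrace_rankOne (e : OrthonormalBasis ι ℂ N) (A : N →ₗ[ℂ] M) :
    partialTrace (InnerProductSpace.rankOne ℂ (∑ j, A (e j) ⊗ₜ[ℂ] e j)
      (∑ j, A (e j) ⊗ₜ[ℂ] e j)).toLinearMap = A ∘ₗ LinearMap.adjoint A := by
  classical
  have h : (InnerProductSpace.rankOne ℂ (∑ j, A (e j) ⊗ₜ[ℂ] e j)
      (∑ j, A (e j) ⊗ₜ[ℂ] e j)).toLinearMap = ∑ j, ∑ k,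
        TensorProduct.map (InnerProductSpace.rankOne ℂ (A (e j)) (A (e k))).toLinearMap
          (InnerProductSpace.rankOne ℂ (e j) (e k)).toLinearMap := by
    simp only [← toLinearMap_rankOne_tmul, map_sum, ContinuousLinearMap.toLinearMap_sum,
      sum_apply]
    exact Finset.sum_comm
  rw [h]
  simp only [map_sum, partialTrace_map, InnerProductSpace.trace_rankOne, e.inner_eq_ite]
  simp only [ite_smul, one_smul, zero_smul, Finset.sum_ite_eq',
    Finset.mem_univ, if_true]
  ext x
  rw [LinearMap.comp_apply, ← e.sum_repr' (LinearMap.adjoint A x), map_sum]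
  simp [LinearMap.sum_apply, LinearMap.adjoint_inner_right]

/-- `Y` sits in the conjugate-linear slot, so its matrix entries enter conjugated; this is why
`conjOp` appears. -/
theorem inner_lTensor_sum_tmul (e : OrthonormalBasis ι ℂ N) (A B : N →ₗ[ℂ] M) (Y : N →ₗ[ℂ] N) :
    inner ℂ (Y.lTensor M (∑ j, A (e j) ⊗ₜ[ℂ] e j)) (∑ j, B (e j) ⊗ₜ[ℂ] e j)
      = LinearMap.trace ℂ N (LinearMap.adjoint A ∘ₗ B ∘ₗ conjOp e Y) := by
  rw [LinearMap.trace_eq_sum_inner _ e, map_sum, sum_inner]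
  refine Finset.sum_congr rfl fun j _ => ?_
  rw [LinearMap.comp_apply, LinearMap.adjoint_inner_right, LinearMap.comp_apply, conjOp_apply,
    basisConj_basis, basisConj_apply, map_sum, inner_sum, inner_sum]
  refine Finset.sum_congr rfl fun k _ => ?_
  rw [LinearMap.lTensor_tmul, TensorProduct.inner_tmul, map_smul, inner_smul_right, mul_comm]

/-- The fidelity of the reductions of two vectors bounds their overlap after a contraction of
the traced-out factor. -/
theorem norm_inner_lTensor_le_fid (φ₁ φ₂ : M ⊗[ℂ] N) {Y : N →ₗ[ℂ] N} (hY : ∀ x, ‖Y x‖ ≤ ‖x‖) :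
    ‖inner ℂ (Y.lTensor M φ₁) φ₂‖ ≤
      fid (LinearMap.toContinuousLinearMap
          (partialTrace (InnerProductSpace.rankOne ℂ φ₁ φ₁).toLinearMap))
        (LinearMap.toContinuousLinearMap
          (partialTrace (InnerProductSpace.rankOne ℂ φ₂ φ₂).toLinearMap)) := by
  let e := stdOrthonormalBasis ℂ N
  obtain ⟨A, rfl⟩ := exists_eq_sum_tmul_basis e φ₁
  obtain ⟨B, rfl⟩ := exists_eq_sum_tmul_basis e φ₂
  rw [inner_lTensor_sum_tmul]
  refine norm_trace_le_fid A B (partialTrace_rankOne e A) (partialTrace_rankOne e B) fun x => ?_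
  rw [norm_conjOp_apply, ← norm_basisConj e x]
  exact hY _

/-- The fidelity of the reductions of two vectors is their overlap after some unitary of the
traced-out factor. -/
theorem exists_inner_lTensor_eq_fid (φ₁ φ₂ : M ⊗[ℂ] N) : ∃ Y : N →ₗᵢ[ℂ] N,
    inner ℂ (Y.toLinearMap.lTensor M φ₁) φ₂ =
      (fid (LinearMap.toContinuousLinearMap
          (partialTrace (InnerProductSpace.rankOne ℂ φ₁ φ₁).toLinearMap))
        (LinearMap.toContinuousLinearMap
          (partialTrace (InnerProductSpace.rankOne ℂ φ₂ φ₂).toLinearMap)) : ℂ) := by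
  let e := stdOrthonormalBasis ℂ N
  obtain ⟨A, rfl⟩ := exists_eq_sum_tmul_basis e φ₁
  obtain ⟨B, rfl⟩ := exists_eq_sum_tmul_basis e φ₂
  obtain ⟨W, hW⟩ := exists_trace_eq_fid A B
    (F₁ := LinearMap.toContinuousLinearMap _) (F₂ := LinearMap.toContinuousLinearMap _)
    (partialTrace_rankOne e A) (partialTrace_rankOne e B)
  -- Taking the conjugate of `W` makes the two conjugations cancel in the trace formula.
  refine ⟨⟨conjOp e W.toLinearEquiv.toLinearMap, fun x => ?_⟩, ?_⟩
  · rw [norm_conjOp_apply]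
    exact (W.norm_map _).trans (norm_basisConj e x)
  · rw [← hW, inner_lTensor_sum_tmul]
    change LinearMap.trace ℂ N (_ ∘ₗ _ ∘ₗ conjOp e (conjOp e _)) = _
    rw [conjOp_conjOp]

end Purification

/-! ### Partial inner products -/

section Slice

variable {M N : Type*} [NormedAddCommGroup M] [InnerProductSpace ℂ M]
  [NormedAddCommGroup N] [InnerProductSpace ℂ N]

/-- The partial inner product `m ⊗ n ↦ ⟪n', n⟫ m`. -/
def rightSlice (n' : N) : M ⊗[ℂ] N →ₗ[ℂ] M :=
  (TensorProduct.rid ℂ M).toLinearMap ∘ₗ (innerₛₗ ℂ n').lTensor M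

@[simp] theorem rightSlice_tmul (n' : N) (m : M) (n : N) :
    rightSlice n' (m ⊗ₜ[ℂ] n) = inner ℂ n' n • m := by
  simp [rightSlice]

theorem inner_rightSlice (m : M) (n' : N) (x : M ⊗[ℂ] N) :
    inner ℂ m (rightSlice n' x) = inner ℂ (m ⊗ₜ[ℂ] n') x := by
  induction x with
  | zero => simp
  | tmul a b => simp [mul_comm]
  | add x y hx hy => simp [inner_add_right, hx, hy]

theorem rightSlice_rTensor (n' : N) (f : M →ₗ[ℂ] M) (x : M ⊗[ℂ] N) :
    rightSlice n' (f.rTensor N x) = f (rightSlice n' x) := by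
  induction x with
  | zero => simp
  | tmul a b => simp
  | add x y hx hy => simp [hx, hy]

theorem sum_rightSlice_tmul {ι : Type*} [Fintype ι] (b : OrthonormalBasis ι ℂ N) (x : M ⊗[ℂ] N) :
    ∑ j, rightSlice (b j) x ⊗ₜ[ℂ] b j = x := by
  induction x with
  | zero => simp
  | tmul m n =>
    simp only [rightSlice_tmul, TensorProduct.smul_tmul]
    rw [← TensorProduct.tmul_sum, b.sum_repr']
  | add x y hx hy => simp only [map_add, TensorProduct.add_tmul, Finset.sum_add_distrib, hx, hy]

end Slice

/-! ### Schur's lemma and the commutant of an irrep -/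

section Schur

variable {G M N : Type*} [Group G] [NormedAddCommGroup M] [InnerProductSpace ℂ M]
  [NormedAddCommGroup N] [InnerProductSpace ℂ N]

/-- An intertwiner of inequivalent irreps vanishes. -/
theorem eq_zero_of_inequivalent {U : G →* (M ≃ₗᵢ[ℂ] M)} {U' : G →* (N ≃ₗᵢ[ℂ] N)}
    (hU : (toRepresentation U).IsIrreducible) (hU' : (toRepresentation U').IsIrreducible)
    (h : IsEmpty ((toRepresentation U).Equiv (toRepresentation U')))
    (f : M →ₗ[ℂ] N) (hf : ∀ g x, f (U g x) = U' g (f x)) : f = 0 := by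
  let F : (toRepresentation U).IntertwiningMap (toRepresentation U') :=
    f.intertwiningMap_of_isIntertwiningMap _ _ hf
  have hF : F = 0 := Subsingleton.elim _ _
  exact congrArg Representation.IntertwiningMap.toLinearMap hF

/-- A self-intertwiner of an irrep is a scalar. -/
theorem exists_eq_smul_of_irreducible [FiniteDimensional ℂ M] {U : G →* (M ≃ₗᵢ[ℂ] M)}
    (hU : (toRepresentation U).IsIrreducible)
    (f : M →ₗ[ℂ] M) (hf : ∀ g x, f (U g x) = U g (f x)) : ∃ c : ℂ, ∀ x, f x = c • x := by
  let F : (toRepresentation U).IntertwiningMap (toRepresentation U) :=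
    f.intertwiningMap_of_isIntertwiningMap _ _ hf
  obtain ⟨c, hc⟩ := (Representation.IsIrreducible.algebraMap_intertwiningMap_bijective_of_isAlgClosed
    (ρ := toRepresentation U)).2 F
  exact ⟨c, fun x => (DFunLike.congr_fun hc x).symm⟩

theorem exists_norm_eq_one_of_irreducible {U : G →* (M ≃ₗᵢ[ℂ] M)}
    (hU : (toRepresentation U).IsIrreducible) : ∃ m : M, ‖m‖ = 1 := by
  by_contra! h
  have hsub : ∀ m : M, m = 0 := fun m => by
    by_contra hm
    exact h ((‖m‖⁻¹ : ℂ) • m) (by simp [norm_smul, hm])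
  have : (⊥ : Subrepresentation (toRepresentation U)) = ⊤ :=
    SetLike.ext fun x => by rw [hsub x]; exact iff_of_true (zero_mem (⊥ : Submodule ℂ M)) trivial
  exact bot_ne_top this

/-- An operator on `M ⊗ N` commuting with `U(g) ⊗ 1` for an irrep `U` is of the form `1 ⊗ Y`. -/
theorem exists_eq_lTensor_of_irreducible [FiniteDimensional ℂ M] [FiniteDimensional ℂ N]
    {U : G →* (M ≃ₗᵢ[ℂ] M)}
    (hU : (toRepresentation U).IsIrreducible) (X : M ⊗[ℂ] N →ₗ[ℂ] M ⊗[ℂ] N)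
    (hX : ∀ g m n, X (U g m ⊗ₜ[ℂ] n) = (toRepresentation U g).rTensor N (X (m ⊗ₜ[ℂ] n))) :
    ∃ Y : N →ₗ[ℂ] N, X = Y.lTensor M := by
  obtain ⟨m₀, hm₀⟩ := exists_norm_eq_one_of_irreducible hU
  let leftSlice : M ⊗[ℂ] N →ₗ[ℂ] N :=
    (TensorProduct.lid ℂ N).toLinearMap ∘ₗ (innerₛₗ ℂ m₀).rTensor N
  have hleft : ∀ n' x, inner ℂ n' (leftSlice x) = inner ℂ (m₀ ⊗ₜ[ℂ] n') x := fun n' x => by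
    induction x with
    | zero => simp
    | tmul a b => simp [leftSlice]
    | add x y hx hy => simp only [map_add, inner_add_right, hx, hy]
  -- `Y` is read off from the matrix elements of `X` at the fixed unit vector `m₀`.
  refine ⟨leftSlice ∘ₗ X ∘ₗ TensorProduct.mk ℂ M N m₀, TensorProduct.ext' fun m n => ?_⟩
  refine TensorProduct.ext_iff_inner_left.2 fun m' n' => ?_
  -- For fixed `n` and `n'`, the slice of `X` is a self-intertwiner of `M`, hence a scalar `c`;
  -- comparison at `m₀` identifies `c` with `⟪n', Y n⟫`.
  obtain ⟨c, hc⟩ := exists_eq_smul_of_irreducible hU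
    (rightSlice n' ∘ₗ X ∘ₗ (TensorProduct.mk ℂ M N).flip n) (fun g x => by
      simp only [LinearMap.comp_apply, LinearMap.flip_apply, TensorProduct.mk_apply, hX,
        rightSlice_rTensor]
      rfl)
  have key : ∀ a b, inner ℂ (a ⊗ₜ[ℂ] n') (X (b ⊗ₜ[ℂ] n)) = c * inner ℂ a b := fun a b => by
    rw [← inner_rightSlice, ← inner_smul_right, ← hc]
    rfl
  rw [key, LinearMap.lTensor_tmul, TensorProduct.inner_tmul, LinearMap.comp_apply, hleft,
    LinearMap.comp_apply, TensorProduct.mk_apply, key, inner_self_eq_norm_sq_to_K, hm₀]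
  simp [mul_comm]

end Schur

/-! ### Components with respect to a decomposition, and the two halves of the optimum -/

namespace IrrepDecomposition

variable {G H : Type*} [Group G] [NormedAddCommGroup H] [InnerProductSpace ℂ H]
  {U : G →* (H ≃ₗᵢ[ℂ] H)} (D : IrrepDecomposition U)

theorem apply_incl (g : G) (μ : D.Index) (y : D.M μ ⊗[ℂ] D.N μ) :
    U g (D.incl μ y) = D.incl μ ((toRepresentation (D.irrep μ) g).rTensor (D.N μ) y) := by
  induction y with
  | zero => simp
  | tmul m n => exact D.map_incl g μ m n
  | add x y hx hy => simp only [map_add, hx, hy]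

theorem induction_incl {p : H → Prop} (x : H) (h0 : p 0) (hadd : ∀ x y, p x → p y → p (x + y))
    (hincl : ∀ μ y, p (D.incl μ y)) : p x := by
  have hx : x ∈ ⨆ μ, LinearMap.range (D.incl μ).toLinearMap :=
    D.iSup_range.symm ▸ Submodule.mem_top
  refine Submodule.iSup_induction _ (motive := p) hx ?_ h0 hadd
  rintro μ _ ⟨y, rfl⟩
  exact hincl μ y

variable [FiniteDimensional ℂ H]

/-- The component of a vector in the summand `M_μ ⊗ N_μ`. -/
def component (μ : D.Index) : H →ₗ[ℂ] D.M μ ⊗[ℂ] D.N μ :=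
  LinearMap.adjoint (D.incl μ).toLinearMap

theorem inner_component_left (μ : D.Index) (x : H) (y : D.M μ ⊗[ℂ] D.N μ) :
    inner ℂ (D.component μ x) y = inner ℂ x (D.incl μ y) :=
  LinearMap.adjoint_inner_left _ _ _

theorem inner_component_right (μ : D.Index) (x : H) (y : D.M μ ⊗[ℂ] D.N μ) :
    inner ℂ y (D.component μ x) = inner ℂ (D.incl μ y) x :=
  LinearMap.adjoint_inner_right _ _ _

theorem component_incl_self (μ : D.Index) (y : D.M μ ⊗[ℂ] D.N μ) :
    D.component μ (D.incl μ y) = y :=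
  ext_inner_left ℂ fun z => by rw [inner_component_right, (D.incl μ).inner_map_map]

theorem component_incl_of_ne {μ ν : D.Index} (h : ν ≠ μ) (y : D.M μ ⊗[ℂ] D.N μ) :
    D.component ν (D.incl μ y) = 0 :=
  ext_inner_left ℂ fun z => by rw [inner_component_right, D.orthogonal h, inner_zero_right]

theorem sum_incl_component (x : H) : ∑ μ, D.incl μ (D.component μ x) = x := by
  induction x using D.induction_incl with
  | h0 => simp
  | hadd x y hx hy => simp [Finset.sum_add_distrib, hx, hy]
  | hincl μ y =>
    rw [Finset.sum_eq_single μ, component_incl_self]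
    · intro ν _ h
      rw [component_incl_of_ne D h, map_zero]
    · simp

theorem inner_eq_sum_component (x y : H) :
    inner ℂ x y = ∑ μ, inner ℂ (D.component μ x) (D.component μ y) := by
  conv_lhs => rw [← D.sum_incl_component y, inner_sum]
  exact Finset.sum_congr rfl fun μ _ => (D.inner_component_left μ x _).symm

theorem component_apply (g : G) (μ : D.Index) (x : H) :
    D.component μ (U g x)
      = (toRepresentation (D.irrep μ) g).rTensor (D.N μ) (D.component μ x) := by
  induction x using D.induction_incl with
  | h0 => simp
  | hadd x y hx hy => simp only [map_add, hx, hy]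
  | hincl ν y =>
    rw [apply_incl]
    by_cases h : μ = ν
    · subst h
      rw [component_incl_self, component_incl_self]
    · rw [component_incl_of_ne D h, component_incl_of_ne D h, map_zero]

/-- `Π_μ` is absorbed by the inclusion and by its adjoint, so the component of `ψ` is a purification
of the reduction. -/
theorem pureReduction_eq (ψ : H) (μ : D.Index) :
    D.pureReduction ψ μ = LinearMap.toContinuousLinearMap (partialTrace
      (InnerProductSpace.rankOne ℂ (D.component μ ψ) (D.component μ ψ)).toLinearMap) := by
  rw [pureReduction, reduction]
  congr 2
  have hP : ∀ y, D.proj μ (D.incl μ y) = D.incl μ y := fun y =>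
    Submodule.starProjection_eq_self_iff.2 (LinearMap.mem_range_self (D.incl μ).toLinearMap y)
  have hP' : ∀ x, D.component μ (D.proj μ x) = D.component μ x := fun x =>
    ext_inner_left ℂ fun z => by
      rw [inner_component_right, inner_component_right]
      conv_rhs => rw [← hP z]
      exact (Submodule.inner_starProjection_left_eq_right _ _ _).symm
  refine LinearMap.ext fun y => ?_
  change D.component μ (D.proj μ (inner ℂ ψ (D.proj μ (D.incl μ y)) • ψ)) =
    inner ℂ (D.component μ ψ) y • D.component μ ψ
  rw [hP', hP, map_smul, inner_component_left]

section Upper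

variable {V : H ≃ₗᵢ[ℂ] H} (hV : IsGInvariant U V)
include hV

/-- Slicing the `(ν, μ)` block of `V` in both multiplicity spaces gives an intertwiner of
inequivalent irreps. -/
theorem component_invariant_incl_of_ne {μ ν : D.Index} (h : μ ≠ ν) (y : D.M μ ⊗[ℂ] D.N μ) :
    D.component ν (V (D.incl μ y)) = 0 := by
  induction y with
  | zero => simp
  | add x y hx hy => simp only [map_add, hx, hy, add_zero]
  | tmul m n =>
    refine TensorProduct.ext_iff_inner_left.2 fun m' n' => ?_
    have := eq_zero_of_inequivalent (D.irreducible μ) (D.irreducible ν) (D.inequivalent μ ν h)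
      (rightSlice n' ∘ₗ D.component ν ∘ₗ V.toLinearEquiv.toLinearMap ∘ₗ
        (D.incl μ).toLinearMap ∘ₗ (TensorProduct.mk ℂ (D.M μ) (D.N μ)).flip n) (fun g x => by
        change rightSlice n' (D.component ν (V (D.incl μ (D.irrep μ g x ⊗ₜ[ℂ] n)))) = _
        rw [← D.map_incl]
        have h1 := DFunLike.congr_fun (hV g) (D.incl μ (x ⊗ₜ[ℂ] n))
        change V (U g _) = U g (V _) at h1
        rw [h1, component_apply, rightSlice_rTensor]
        rfl)
    rw [← inner_rightSlice, inner_zero_right]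
    have h2 : rightSlice n' (D.component ν (V (D.incl μ (m ⊗ₜ[ℂ] n)))) = 0 :=
      LinearMap.congr_fun this m
    rw [h2, inner_zero_right]

/-- `1 ⊗ Y` is a compression of a unitary, and testing it on `m ⊗ n` with `‖m‖ = 1` shows that `Y`
is a contraction. The upper bound needs no more, so unitarity of `Y` is not established. -/
theorem exists_component_invariant_incl (μ : D.Index) :
    ∃ Y : D.N μ →ₗ[ℂ] D.N μ, (∀ n, ‖Y n‖ ≤ ‖n‖) ∧
      ∀ y, D.component μ (V (D.incl μ y)) = Y.lTensor (D.M μ) y := by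
  obtain ⟨Y, hY⟩ := exists_eq_lTensor_of_irreducible (D.irreducible μ)
    (D.component μ ∘ₗ V.toLinearEquiv.toLinearMap ∘ₗ (D.incl μ).toLinearMap) (fun g m n => by
      change D.component μ (V (D.incl μ (D.irrep μ g m ⊗ₜ[ℂ] n))) = _
      rw [← D.map_incl]
      have h1 := DFunLike.congr_fun (hV g) (D.incl μ (m ⊗ₜ[ℂ] n))
      change V (U g _) = U g (V _) at h1
      rw [h1, component_apply]
      rfl)
  have hY' : ∀ y, D.component μ (V (D.incl μ y)) = Y.lTensor (D.M μ) y :=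
    fun y => LinearMap.congr_fun hY y
  refine ⟨Y, fun n => ?_, hY'⟩
  obtain ⟨m, hm⟩ := exists_norm_eq_one_of_irreducible (D.irreducible μ)
  have h := norm_adjoint_le_of_contraction (T := (D.incl μ).toLinearMap)
    (fun x => ((D.incl μ).norm_map x).le) (V (D.incl μ (m ⊗ₜ[ℂ] n)))
  change ‖D.component μ _‖ ≤ _ at h
  rwa [hY', V.norm_map, (D.incl μ).norm_map, LinearMap.lTensor_tmul, TensorProduct.norm_tmul,
    TensorProduct.norm_tmul, hm, one_mul, one_mul] at h

theorem norm_inner_invariant_le (ψ₁ ψ₂ : H) : ‖inner ℂ ψ₂ (V ψ₁)‖ ≤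
    ∑ μ, fid (D.pureReduction ψ₁ μ) (D.pureReduction ψ₂ μ) := by
  rw [norm_inner_symm, D.inner_eq_sum_component]
  refine (norm_sum_le _ _).trans (Finset.sum_le_sum fun μ _ => ?_)
  obtain ⟨Y, hY, hVY⟩ := D.exists_component_invariant_incl hV μ
  have h : D.component μ (V ψ₁) = Y.lTensor (D.M μ) (D.component μ ψ₁) := by
    conv_lhs => rw [← D.sum_incl_component ψ₁, map_sum, map_sum]
    rw [Finset.sum_eq_single μ, hVY]
    · intro ν _ hν
      exact D.component_invariant_incl_of_ne hV hν _
    · simp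
  rw [h, pureReduction_eq, pureReduction_eq]
  exact norm_inner_lTensor_le_fid _ _ hY

end Upper

/-- The unitary `⨁_μ 1 ⊗ Y_μ`. -/
def ofMultiplicity (Y : ∀ μ, D.N μ →ₗᵢ[ℂ] D.N μ) : H →ₗ[ℂ] H :=
  ∑ μ, (D.incl μ).toLinearMap ∘ₗ (Y μ).toLinearMap.lTensor (D.M μ) ∘ₗ D.component μ

theorem component_ofMultiplicity (Y : ∀ μ, D.N μ →ₗᵢ[ℂ] D.N μ) (μ : D.Index) (x : H) :
    D.component μ (D.ofMultiplicity Y x)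
      = (Y μ).toLinearMap.lTensor (D.M μ) (D.component μ x) := by
  simp only [ofMultiplicity, LinearMap.sum_apply, map_sum, LinearMap.comp_apply]
  rw [Finset.sum_eq_single μ]
  · exact D.component_incl_self μ _
  · intro ν _ hν
    exact D.component_incl_of_ne hν.symm _
  · simp

theorem ext_component {x y : H} (h : ∀ μ, D.component μ x = D.component μ y) : x = y := by
  rw [← D.sum_incl_component x, ← D.sum_incl_component y]
  simp only [h]

theorem exists_invariant_eq (ψ₁ ψ₂ : H) : ∃ V : H ≃ₗᵢ[ℂ] H, IsGInvariant U V ∧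
    ‖inner ℂ ψ₂ (V ψ₁)‖ = ∑ μ, fid (D.pureReduction ψ₁ μ) (D.pureReduction ψ₂ μ) := by
  choose Y hY using fun μ => exists_inner_lTensor_eq_fid (D.component μ ψ₁) (D.component μ ψ₂)
  let V₀ : H →ₗᵢ[ℂ] H := (D.ofMultiplicity Y).isometryOfInner fun x y => by
    rw [D.inner_eq_sum_component, D.inner_eq_sum_component x y]
    refine Finset.sum_congr rfl fun μ _ => ?_
    rw [component_ofMultiplicity, component_ofMultiplicity]
    exact ((Y μ).lTensor (D.M μ)).inner_map_map _ _
  let V := V₀.toLinearIsometryEquiv rfl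
  have hV : ∀ x, V x = D.ofMultiplicity Y x := fun x => rfl
  refine ⟨V, fun g => LinearIsometryEquiv.ext fun x => ?_, ?_⟩
  · change V (U g x) = U g (V x)
    refine D.ext_component fun μ => ?_
    rw [hV, hV, component_apply, component_ofMultiplicity, component_ofMultiplicity,
      component_apply]
    exact LinearMap.congr_fun ((LinearMap.lTensor_comp_rTensor ..).trans
      (LinearMap.rTensor_comp_lTensor ..).symm) (D.component μ x)
  · rw [norm_inner_symm, D.inner_eq_sum_component]
    have h : ∀ μ, inner ℂ (D.component μ (V ψ₁)) (D.component μ ψ₂)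
        = (fid (D.pureReduction ψ₁ μ) (D.pureReduction ψ₂ μ) : ℂ) := fun μ => by
      rw [hV, component_ofMultiplicity, hY, pureReduction_eq, pureReduction_eq]
    simp only [h]
    rw [← Complex.ofReal_sum, Complex.norm_real, Real.norm_of_nonneg]
    refine Finset.sum_nonneg fun μ _ => ?_
    -- Nonnegativity of the fidelity: it bounds a norm, here with `Y = 1`.
    have := norm_inner_lTensor_le_fid (D.component μ ψ₁) (D.component μ ψ₂)
      (Y := LinearMap.id) (fun x => le_rfl)
    rw [← pureReduction_eq, ← pureReduction_eq] at this
    exact (norm_nonneg _).trans this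

end IrrepDecomposition

/-! ### Intertwiners and isotypic components -/

section Intertwiners

variable {G M M' H : Type*} [Group G] [NormedAddCommGroup M] [InnerProductSpace ℂ M]
  [FiniteDimensional ℂ M] [NormedAddCommGroup M'] [InnerProductSpace ℂ M']
  [NormedAddCommGroup H] [InnerProductSpace ℂ H] [FiniteDimensional ℂ H]
  {ρ : G →* (M ≃ₗᵢ[ℂ] M)} {ρ' : G →* (M' ≃ₗᵢ[ℂ] M')} {U : G →* (H ≃ₗᵢ[ℂ] H)}

/-- The adjoint of an intertwiner of unitary representations is an intertwiner. -/
theorem adjoint_intertwines {f : M →ₗ[ℂ] H} (hf : ∀ g m, f (ρ g m) = U g (f m)) (g : G) (x : H) :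
    LinearMap.adjoint f (U g x) = ρ g (LinearMap.adjoint f x) := by
  refine ext_inner_left ℂ fun m => ?_
  obtain ⟨m, rfl⟩ := (ρ g).surjective m
  rw [LinearMap.adjoint_inner_right, hf, (U g).inner_map_map, (ρ g).inner_map_map,
    LinearMap.adjoint_inner_right]

/-- Images of inequivalent irreps are orthogonal. -/
theorem inner_intertwiners_eq_zero (hρ : (toRepresentation ρ).IsIrreducible)
    (hρ' : (toRepresentation ρ').IsIrreducible)
    (h : IsEmpty ((toRepresentation ρ').Equiv (toRepresentation ρ)))
    {f : M →ₗ[ℂ] H} (hf : ∀ g m, f (ρ g m) = U g (f m))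
    {f' : M' →ₗ[ℂ] H} (hf' : ∀ g m, f' (ρ' g m) = U g (f' m)) (m : M) (m' : M') :
    inner ℂ (f m) (f' m') = 0 := by
  have h0 := eq_zero_of_inequivalent hρ' hρ h (LinearMap.adjoint f ∘ₗ f') fun g x => by
    rw [LinearMap.comp_apply, hf', adjoint_intertwines hf, LinearMap.comp_apply]
  rw [← LinearMap.adjoint_inner_right, ← LinearMap.comp_apply, h0, LinearMap.zero_apply,
    inner_zero_right]

/-- Two intertwiners out of the same irrep are proportional to isometries with a common
polarization. -/
theorem inner_intertwiners_eq (hρ : (toRepresentation ρ).IsIrreducible)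
    {f f' : M →ₗ[ℂ] H} (hf : ∀ g m, f (ρ g m) = U g (f m))
    (hf' : ∀ g m, f' (ρ g m) = U g (f' m)) {m₀ : M} (hm₀ : ‖m₀‖ = 1) (m m' : M) :
    inner ℂ (f m) (f' m') = inner ℂ (f m₀) (f' m₀) * inner ℂ m m' := by
  obtain ⟨c, hc⟩ := exists_eq_smul_of_irreducible hρ (LinearMap.adjoint f ∘ₗ f') fun g x => by
    rw [LinearMap.comp_apply, hf', adjoint_intertwines hf, LinearMap.comp_apply]
  have key : ∀ a b, inner ℂ (f a) (f' b) = c * inner ℂ a b := fun a b => by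
    rw [← LinearMap.adjoint_inner_right, ← LinearMap.comp_apply, hc, inner_smul_right]
  rw [key, key, inner_self_eq_norm_sq_to_K, hm₀]
  simp

variable (ρ U) in
/-- The space of intertwiners from `ρ` to `U`. -/
def intertwiners : Submodule ℂ (M →ₗ[ℂ] H) where
  carrier := {f | ∀ g m, f (ρ g m) = U g (f m)}
  add_mem' hf hf' g m := by
    rw [LinearMap.add_apply, hf g m, hf' g m, LinearMap.add_apply, map_add]
  zero_mem' g m := by simp
  smul_mem' c f hf g m := by
    rw [LinearMap.smul_apply, hf g m, LinearMap.smul_apply, map_smul]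

variable (U) in
/-- The isotypic component of an irrep. -/
theorem exists_isotypic_inclusion (hρ : (toRepresentation ρ).IsIrreducible) :
    ∃ (k : ℕ) (incl : (M ⊗[ℂ] EuclideanSpace ℂ (ULift.{w} (Fin k))) →ₗᵢ[ℂ] H),
      (∀ g m n, U g (incl (m ⊗ₜ[ℂ] n)) = incl (ρ g m ⊗ₜ[ℂ] n)) ∧
      ∀ f ∈ intertwiners ρ U, ∀ m, f m ∈ LinearMap.range incl.toLinearMap := by
  classical
  obtain ⟨m₀, hm₀⟩ := exists_norm_eq_one_of_irreducible hρ
  -- An intertwiner is determined by its value at `m₀`, so these values model the intertwiner space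
  -- with an inner product inherited from `H`. An orthonormal basis `e` lifts to isometric
  -- intertwiners `f j` with mutually orthogonal ranges.
  let N : Submodule ℂ H := (intertwiners ρ U).map (LinearMap.applyₗ m₀)
  let e : OrthonormalBasis (ULift.{w} (Fin (Module.finrank ℂ N))) ℂ N :=
    (stdOrthonormalBasis ℂ N).reindex Equiv.ulift.symm
  let b := EuclideanSpace.basisFun (ULift.{w} (Fin (Module.finrank ℂ N))) ℂ
  have hN : ∀ j, ∃ f ∈ intertwiners ρ U, f m₀ = e j := fun j => (e j).2
  choose f hf hfe using hN
  let F : M ⊗[ℂ] EuclideanSpace ℂ (ULift.{w} (Fin (Module.finrank ℂ N))) →ₗ[ℂ] H :=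
    ∑ j, f j ∘ₗ rightSlice (b j)
  have hF : ∀ x, F x = ∑ j, f j (rightSlice (b j) x) := fun x => by
    simp [F, LinearMap.sum_apply]
  refine ⟨Module.finrank ℂ N, F.isometryOfInner fun x y => ?_, fun g m n => ?_, fun h hh m => ?_⟩
  · rw [hF, hF, sum_inner]
    conv_rhs => rw [← sum_rightSlice_tmul b x, sum_inner]
    refine Finset.sum_congr rfl fun j _ => ?_
    rw [inner_sum, Finset.sum_eq_single j, inner_intertwiners_eq hρ (hf j) (hf j) hm₀, hfe,
      ← Submodule.coe_inner, e.inner_eq_one, one_mul, inner_rightSlice]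
    · intro k _ hk
      rw [inner_intertwiners_eq hρ (hf j) (hf k) hm₀, hfe, hfe, ← Submodule.coe_inner,
        e.inner_eq_zero hk.symm, zero_mul]
    · simp
  · change U g (F _) = F _
    rw [hF, hF, map_sum]
    refine Finset.sum_congr rfl fun j _ => ?_
    rw [← hf j g, rightSlice_tmul, rightSlice_tmul, map_smul]
  · let y : N := ⟨h m₀, h, hh, rfl⟩
    let h' : M →ₗ[ℂ] H := ∑ j, inner ℂ (e j) y • f j
    have hh' : h' ∈ intertwiners ρ U :=
      Submodule.sum_mem _ fun j _ => Submodule.smul_mem _ _ (hf j)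
    have h0 : h m₀ = h' m₀ := by
      have := congrArg Subtype.val (e.sum_repr' y)
      simp only [Submodule.coe_sum, Submodule.coe_smul, ← hfe] at this
      rw [LinearMap.sum_apply]
      exact this.symm
    -- `h - h'` vanishes at `m₀`, and the norms of its values are governed by its norm there.
    have heq : h m = h' m := by
      have h1 := inner_intertwiners_eq hρ (sub_mem hh hh') (sub_mem hh hh') hm₀ m m
      rw [LinearMap.sub_apply h h' m₀, h0, sub_self, inner_zero_left, zero_mul,
        inner_self_eq_zero, LinearMap.sub_apply, sub_eq_zero] at h1
      exact h1
    refine ⟨m ⊗ₜ[ℂ] ∑ j, inner ℂ (e j) y • b j, ?_⟩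
    change F _ = _
    rw [hF, heq, LinearMap.sum_apply]
    refine Finset.sum_congr rfl fun j _ => ?_
    rw [rightSlice_tmul, b.orthonormal.inner_right_fintype, map_smul, LinearMap.smul_apply]

end Intertwiners

/-! ### Irreps inside invariant subspaces -/

section Subrepresentations

variable {G H : Type*} [Group G] [NormedAddCommGroup H] [InnerProductSpace ℂ H]
  (U : G →* (H ≃ₗᵢ[ℂ] H))

theorem apply_apply_inv (g : G) (x : H) : U g (U g⁻¹ x) = x := by
  have h := DFunLike.congr_fun (map_mul U g g⁻¹) x
  rw [mul_inv_cancel, map_one] at h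
  exact h.symm

/-- A unitary representation restricts along an isometry with invariant range. -/
theorem exists_restriction {E : Type*} [NormedAddCommGroup E] [InnerProductSpace ℂ E]
    (j : E →ₗᵢ[ℂ] H)
    (hj : ∀ g, ∀ x ∈ LinearMap.range j.toLinearMap, U g x ∈ LinearMap.range j.toLinearMap) :
    ∃ ρ : G →* (E ≃ₗᵢ[ℂ] E), ∀ g x, j (ρ g x) = U g (j x) := by
  have h : ∀ g x, ∃ y, j y = U g (j x) := fun g x => hj g (j x) ⟨x, rfl⟩
  choose r hr using h
  have hinv : ∀ g x, r g (r g⁻¹ x) = x := fun g x => j.injective <| by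
    rw [hr, hr, apply_apply_inv]
  let L : ∀ g, E ≃ₗᵢ[ℂ] E := fun g =>
    { toFun := r g
      invFun := r g⁻¹
      map_add' := fun x y => j.injective (by simp only [hr, map_add])
      map_smul' := fun c x => j.injective (by simp only [hr, map_smul, RingHom.id_apply])
      left_inv := fun x => by simpa using hinv g⁻¹ x
      right_inv := hinv g
      norm_map' := fun x => by
        change ‖r g x‖ = _
        rw [← j.norm_map, hr, (U g).norm_map, j.norm_map] }
  refine ⟨⟨⟨L, ?_⟩, ?_⟩, hr⟩
  · ext1 x
    refine j.injective ((hr 1 x).trans ?_)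
    rw [map_one]; rfl
  · intro g g'
    ext1 x
    refine j.injective ((hr (g * g') x).trans ?_)
    change _ = j (r g (r g' x))
    rw [hr, hr, map_mul]; rfl

/-- Every nonzero invariant subspace contains the isometric image of an irrep. -/
theorem exists_irrep_in_invariant_submodule [FiniteDimensional ℂ H] {K : Submodule ℂ H}
    (hK : K ≠ ⊥) (hinv : ∀ g, ∀ x ∈ K, U g x ∈ K) :
    ∃ (d : ℕ) (ρ : G →* (EuclideanSpace ℂ (ULift.{w} (Fin d)) ≃ₗᵢ[ℂ]
        EuclideanSpace ℂ (ULift.{w} (Fin d))))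
      (j : EuclideanSpace ℂ (ULift.{w} (Fin d)) →ₗᵢ[ℂ] H),
      (toRepresentation ρ).IsIrreducible ∧ (∀ g x, j (ρ g x) = U g (j x)) ∧ ∀ x, j x ∈ K := by
  -- A minimal nonzero invariant subspace of `K` carries the irrep.
  obtain ⟨W, ⟨hW0, hWK, hWinv⟩, hmin⟩ := WellFounded.has_min (wellFounded_lt (α := Submodule ℂ H))
    {W | W ≠ ⊥ ∧ W ≤ K ∧ ∀ g, ∀ x ∈ W, U g x ∈ W} ⟨K, hK, le_rfl, hinv⟩
  let e : OrthonormalBasis (ULift.{w} (Fin (Module.finrank ℂ W))) ℂ W :=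
    (stdOrthonormalBasis ℂ W).reindex Equiv.ulift.symm
  let j : EuclideanSpace ℂ (ULift.{w} (Fin (Module.finrank ℂ W))) →ₗᵢ[ℂ] H :=
    W.subtypeₗᵢ.comp e.repr.symm.toLinearIsometry
  have hjW : ∀ x, j x ∈ W := fun x => (e.repr.symm x).2
  have hWj : ∀ y ∈ W, ∃ x, j x = y := fun y hy =>
    ⟨e.repr ⟨y, hy⟩, congrArg Subtype.val (e.repr.symm_apply_apply ⟨y, hy⟩)⟩
  obtain ⟨ρ, hρ⟩ := exists_restriction U j (by
    rintro g _ ⟨x, rfl⟩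
    exact hWj _ (hWinv g _ (hjW x)))
  refine ⟨_, ρ, j, ?_, hρ, fun x => hWK (hjW x)⟩
  refine { exists_pair_ne := ⟨⊥, ⊤, fun h => ?_⟩, eq_bot_or_eq_top := fun S => ?_ }
  · obtain ⟨y, hy, hy0⟩ := W.ne_bot_iff.1 hW0
    obtain ⟨x, rfl⟩ := hWj y hy
    have hx : x ∈ (⊥ : Subrepresentation (toRepresentation ρ)) := h ▸ Submodule.mem_top
    exact hy0 (by rw [(Submodule.mem_bot ℂ).1 hx, map_zero])
  · by_cases hS : S.toSubmodule.map j.toLinearMap = ⊥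
    · left
      refine Subrepresentation.toSubmodule_injective ((Submodule.eq_bot_iff _).2 fun x hx => ?_)
      refine j.injective ?_
      rw [map_zero]
      exact (Submodule.mem_bot ℂ).1 (hS ▸ Submodule.mem_map_of_mem hx)
    · right
      have hle : S.toSubmodule.map j.toLinearMap ≤ W := by
        rintro _ ⟨x, -, rfl⟩
        exact hjW x
      have hSW : S.toSubmodule.map j.toLinearMap = W := by
        refine hle.eq_of_not_lt (hmin _ ⟨hS, hle.trans hWK, ?_⟩)
        rintro g _ ⟨x, hx, rfl⟩
        exact ⟨ρ g x, S.apply_mem_toSubmodule g hx, hρ g x⟩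
      refine Subrepresentation.toSubmodule_injective ((Submodule.eq_top_iff').2 fun x => ?_)
      obtain ⟨x', hx', h⟩ : j x ∈ S.toSubmodule.map j.toLinearMap := by rw [hSW]; exact hjW x
      rwa [← j.injective h]

end Subrepresentations

/-! ### Existence of the decomposition -/

section Existence

variable {G : Type u} {H : Type v} [Group G] [NormedAddCommGroup H] [InnerProductSpace ℂ H]

/-- A matrix irrep together with an equivariant isometry into `U`. -/
structure EmbeddedIrrep (U : G →* (H ≃ₗᵢ[ℂ] H)) where
  /-- the dimension -/
  dim : ℕ
  /-- the irrep -/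
  irrep : G →* (EuclideanSpace ℂ (ULift.{w} (Fin dim)) ≃ₗᵢ[ℂ] EuclideanSpace ℂ (ULift.{w} (Fin dim)))
  /-- the embedding -/
  emb : EuclideanSpace ℂ (ULift.{w} (Fin dim)) →ₗᵢ[ℂ] H
  irreducible : (toRepresentation irrep).IsIrreducible
  map_emb : ∀ g x, emb (irrep g x) = U g (emb x)

namespace EmbeddedIrrep

variable (U : G →* (H ≃ₗᵢ[ℂ] H))

/-- Equivalence of embedded irreps as representations. -/
instance setoid : Setoid (EmbeddedIrrep.{w} U) where
  r σ τ := Nonempty ((toRepresentation σ.irrep).Equiv (toRepresentation τ.irrep))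
  iseqv := ⟨fun _ => ⟨.refl _⟩, fun ⟨e⟩ => ⟨e.symm⟩, fun ⟨e⟩ ⟨e'⟩ => ⟨e.trans e'⟩⟩

/-- A representative of an equivalence class of embedded irreps. -/
abbrev rep (q : Quotient (setoid.{w} U)) : EmbeddedIrrep.{w} U := Quotient.out q

theorem isEmpty_equiv_rep {q q' : Quotient (setoid.{w} U)} (h : q ≠ q') :
    IsEmpty ((toRepresentation (rep U q).irrep).Equiv (toRepresentation (rep U q').irrep)) := by
  by_contra hne
  rw [not_isEmpty_iff] at hne
  exact h (by rw [← Quotient.out_eq q, ← Quotient.out_eq q']; exact Quotient.sound hne)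

variable [FiniteDimensional ℂ H]

/-- One unit vector from each class, moved into `H`, gives an orthonormal family because
inequivalent irreps have orthogonal images. -/
instance finite_quotient : Finite (Quotient (setoid.{w} U)) := by
  choose m hm using fun q => exists_norm_eq_one_of_irreducible (rep U q).irreducible
  have hon : Orthonormal ℂ fun q => (rep U q).emb (m q) := by
    refine ⟨fun q => by rw [LinearIsometry.norm_map, hm], fun q q' h => ?_⟩
    exact inner_intertwiners_eq_zero (rep U q).irreducible (rep U q').irreducible
      (isEmpty_equiv_rep U h.symm) (f := (rep U q).emb.toLinearMap) (rep U q).map_emb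
      (f' := (rep U q').emb.toLinearMap) (rep U q').map_emb _ _
  exact hon.linearIndependent.finite

end EmbeddedIrrep

open EmbeddedIrrep in
/-- Every finite-dimensional unitary representation decomposes into irreps. -/
theorem nonempty_irrepDecomposition [FiniteDimensional ℂ H] (U : G →* (H ≃ₗᵢ[ℂ] H)) :
    Nonempty (IrrepDecomposition.{w} U) := by
  obtain ⟨n, ⟨ε⟩⟩ := Finite.exists_equiv_fin (Quotient (setoid.{w} U))
  choose k incl hincl hrange using fun q =>
    exists_isotypic_inclusion.{w} U (rep U q).irreducible
  have horth : ∀ q q', q ≠ q' → ∀ x y, inner ℂ (incl q x) (incl q' y) = 0 := by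
    intro q q' h x y
    induction x with
    | zero => simp
    | add x x' hx hx' => rw [map_add, inner_add_left, hx, hx', add_zero]
    | tmul m a =>
      induction y with
      | zero => simp
      | add y y' hy hy' => rw [map_add, inner_add_right, hy, hy', add_zero]
      | tmul m' a' =>
        exact inner_intertwiners_eq_zero (rep U q).irreducible (rep U q').irreducible
          (isEmpty_equiv_rep U h.symm)
          (f := (incl q).toLinearMap ∘ₗ (TensorProduct.mk ℂ _ _).flip a)
          (fun g m => (hincl q g m a).symm)
          (f' := (incl q').toLinearMap ∘ₗ (TensorProduct.mk ℂ _ _).flip a')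
          (fun g m => (hincl q' g m a').symm) m m'
  let S : Submodule ℂ H := ⨆ q, LinearMap.range (incl q).toLinearMap
  have hS : ∀ g, ∀ x ∈ S, U g x ∈ S := by
    intro g x hx
    refine Submodule.iSup_induction _ (motive := fun x => U g x ∈ S) hx ?_ (by simp)
      (fun x y hx hy => by rw [map_add]; exact add_mem hx hy)
    rintro q _ ⟨z, rfl⟩
    change U g (incl q z) ∈ S
    induction z with
    | zero => simp
    | add z z' hz hz' => rw [map_add, map_add]; exact add_mem hz hz'
    | tmul m a =>
      rw [hincl]
      exact Submodule.mem_iSup_of_mem q ⟨_, rfl⟩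
  have htop : S = ⊤ := by
    rw [← Submodule.orthogonal_eq_bot_iff]
    by_contra hne
    obtain ⟨d, ρ, j, hρ, hj, hjS⟩ := exists_irrep_in_invariant_submodule.{w} U hne (by
      intro g x hx y hy
      have h1 : inner ℂ (U g⁻¹ y) x = 0 := hx _ (hS g⁻¹ y hy)
      rwa [← (U g).inner_map_map, apply_apply_inv] at h1)
    let σ : EmbeddedIrrep.{w} U := ⟨d, ρ, j, hρ, hj⟩
    obtain ⟨e⟩ : Nonempty ((toRepresentation (rep U ⟦σ⟧).irrep).Equiv (toRepresentation ρ)) :=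
      Quotient.exact (Quotient.out_eq (⟦σ⟧ : Quotient (setoid.{w} U)))
    obtain ⟨m, hm⟩ := exists_norm_eq_one_of_irreducible (rep U ⟦σ⟧).irreducible
    -- Composing `j` with the equivalence `e` gives an intertwiner out of the representative, so its
    -- values lie in that isotypic block. Thus `j (e m)` lies in both `S` and `Sᗮ`, although `m ≠
    -- 0`.
    have hmem : j (e m) ∈ S := Submodule.mem_iSup_of_mem ⟦σ⟧
      (hrange ⟦σ⟧ (j.toLinearMap ∘ₗ e.toLinearMap) (fun g x => by
        rw [LinearMap.comp_apply, LinearMap.comp_apply]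
        refine Eq.trans ?_ (hj g _)
        exact congrArg j (Representation.IntertwiningMap.isIntertwining _ _ e.toIntertwiningMap g x)) m)
    have h0 : j (e m) = 0 := inner_self_eq_zero.1 (hjS (e m) _ hmem)
    have h1 : e m = 0 := j.injective (h0.trans (map_zero j).symm)
    have h2 : m = 0 := e.toLinearEquiv.map_eq_zero_iff.1 h1
    rw [h2, norm_zero] at hm
    exact zero_ne_one hm
  exact ⟨{
    Index := ULift.{w} (Fin n)
    M := fun μ => EuclideanSpace ℂ (ULift.{w} (Fin (rep U (ε.symm μ.down)).dim))
    N := fun μ => EuclideanSpace ℂ (ULift.{w} (Fin (k (ε.symm μ.down))))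
    irrep := fun μ => (rep U (ε.symm μ.down)).irrep
    irreducible := fun μ => (rep U (ε.symm μ.down)).irreducible
    inequivalent := fun μ ν h => isEmpty_equiv_rep U fun h' =>
      h (ULift.ext _ _ (ε.symm.injective h'))
    incl := fun μ => incl (ε.symm μ.down)
    orthogonal := fun μ ν h => horth _ _ fun h' => h (ULift.ext _ _ (ε.symm.injective h'))
    iSup_range := by
      rw [← htop]
      exact (Equiv.ulift.trans ε.symm).iSup_comp
        (g := fun q => LinearMap.range (incl q).toLinearMap)
    map_incl := fun g μ m n => hincl _ g m n }⟩

end Existence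

end Asymmetry

end

theorem mainTheorem6 {G : Type u} {H : Type v} [Group G] [NormedAddCommGroup H]
    [InnerProductSpace ℂ H] [FiniteDimensional ℂ H] (U : G →* (H ≃ₗᵢ[ℂ] H))
    (ψ₁ ψ₂ : H) (hψ₁ : ‖ψ₁‖ = 1) (hψ₂ : ‖ψ₂‖ = 1) :
    Nonempty (Asymmetry.IrrepDecomposition.{w, u, v} U) ∧
    ∀ D : Asymmetry.IrrepDecomposition.{w, u, v} U,
      (∀ V : H ≃ₗᵢ[ℂ] H, Asymmetry.IsGInvariant U V →
        ‖inner ℂ ψ₂ (V ψ₁)‖ ≤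
          ∑ μ, Asymmetry.fid (D.pureReduction ψ₁ μ) (D.pureReduction ψ₂ μ)) ∧
      ∃ V : H ≃ₗᵢ[ℂ] H, Asymmetry.IsGInvariant U V ∧
        ‖inner ℂ ψ₂ (V ψ₁)‖ =
          ∑ μ, Asymmetry.fid (D.pureReduction ψ₁ μ) (D.pureReduction ψ₂ μ) := by
  refine ⟨Asymmetry.nonempty_irrepDecomposition U, fun D => ⟨fun V hV => ?_, ?_⟩⟩
  · exact D.norm_inner_invariant_le hV ψ₁ ψ₂
  · exact D.exists_invariant_eq ψ₁ ψ₂
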